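/- **LQR robustness margins.** Let $A\in\mathbb R^{n\times n}$, $B\in\mathbb R^{n\times p}$, and let $\|\cdot\|_2$ be the spectral norm. *Controllability.* Put $\mathcal C_k=[B\;AB\;\cdots\;A^{k-1}B]$ and $r_k=\operatorname{rank}\mathcal C_k$ ($r_0=0$). The pair $(A,B)$ is controllable if $r_k=n$ for some $k\le n$; its controllability index is $\kappa=\min\{k\ge 1: r_k=n\}$. *Staircase form.* Split $\mathbb R^n$ into consecutive blocks of sizes $p_i=r_i-r_{i-1}$, $1\le i\le\kappa$. A controllable pair has a staircase form: there is an orthogonal $U$ such that $U'B$ is zero outside its first block row $B_1$, and the blocks $A_{i,j}\in\mathbb R^{p_i\times p_j}$ of $U'AU$ vanish for $i>j+1$. *Robust coupling.* For $\mu>0$, $(A,B)$ is $\mu$-robustly coupled if $\sigma_p(B_1)\ge\mu$ and $\sigma_{p_{i+1}}(A_{i+1,i})\ge\mu$ for all $1\le i\le\kappa-1$, where $\sigma_k$ is the $k$-th largest singular value (these conditions do not depend on the choice of $U$). *Optimal gain for $Q=I_n$, $R=I_p$.* Let $P$ be the positive definite (equivalently, stabilizing) solution of $$P=A'PA+I_n-A'PB(B'PB+I_p)^{-1}B'PA,\qquad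 K_\star=-(B'PB+I_p)^{-1}B'PA .$$ Let $\rho$ denote the spectral radius, and for a matrix $X$ with $\rho(X)<1$ let $\|(zI-X)^{-1}\|_{\mathcal H_\infty}=\sup_{z\in\mathbb C,\,|z|=1}\|(zI-X)^{-1}\|_2$. **Statement.** For every real $c>1$ there is a real polynomial $F$ in three variables, depending only on $c$, such that the following holds for all $n,p$, all $M\ge 1$, $\mu>0$, and every controllable, $\mu$-robustly coupled pair $(A,B)$ with $\|A\|_2,\|B\|_2\le M$ and controllability index $\kappa$. One has $\rho(A+BK_\star)<1$, and $$(1-\rho(A+BK_\star))^{-1}\le F\big((cM/\mu)^\kappa,M^\kappa,\kappa\big),\qquad \|(zI-A-BK_\star)^{-1}\|_{\mathcal H_\infty}\le F\big((cM/\mu)^\kappa,M^\kappa,\kappa\big).$$ If moreover $M\ge c$ or $M/\mu\ge c$, then also $$(1-\rho(A+BK_\star))^{-1}\le F\big((M/\mu)^\kappa,M^\kappa,\kappa\big),\qquad \|(zI-A-BK_\star)^{-1}\|_{\mathcal H_\infty}\le F\big((M/\mu)^\kappa,M^\kappa,\kappa\big).$$ -/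

import Mathlib

open scoped ENNReal Matrix Matrix.Norms.L2Operator

noncomputable section

namespace LQR

/-- The controllability matrix `C_k(A,B) = [B, AB, …, A^{k-1}B]`; its columns are indexed by the
pairs (block, column inside the block). -/
def ctrbMatrix {n p : ℕ} (A : Matrix (Fin n) (Fin n) ℝ) (B : Matrix (Fin n) (Fin p) ℝ) (k : ℕ) :
    Matrix (Fin n) (Fin k × Fin p) ℝ :=
  Matrix.of fun a q => (A ^ (q.1 : ℕ) * B) a q.2

/-- `rank C_k(A,B)`. -/
def ctrbRank {n p : ℕ} (A : Matrix (Fin n) (Fin n) ℝ) (B : Matrix (Fin n) (Fin p) ℝ) (k : ℕ) : ℕ :=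
  (ctrbMatrix A B k).rank

/-- `(A,B)` is controllable: `rank C_k(A,B) = n` for some `k ≤ n`. -/
def Controllable {n p : ℕ} (A : Matrix (Fin n) (Fin n) ℝ) (B : Matrix (Fin n) (Fin p) ℝ) : Prop :=
  ∃ k ≤ n, ctrbRank A B k = n

/-- The controllability index `κ(A,B) = min {k ≥ 1 : rank C_k(A,B) = n}`. -/
def ctrbIndex {n p : ℕ} (A : Matrix (Fin n) (Fin n) ℝ) (B : Matrix (Fin n) (Fin p) ℝ) : ℕ :=
  sInf {k : ℕ | 1 ≤ k ∧ ctrbRank A B k = n}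

/-- The singular value `σ_k(X)`, for `k ≥ 1`, with `σ_1(X) ≥ σ_2(X) ≥ …`. (Mathlib's sequence of
singular values starts at index `0`.) -/
def singularValue {m n : Type*} [Fintype m] [Fintype n] [DecidableEq m] [DecidableEq n]
    (k : ℕ) (X : Matrix m n ℝ) : ℝ :=
  (Matrix.toEuclideanLin X).singularValues (k - 1)

/-- The size `p_i = rank C_i - rank C_{i-1}` of the `i`-th block of the staircase form, `i ≥ 1`. -/
def blockSize {n p : ℕ} (A : Matrix (Fin n) (Fin n) ℝ) (B : Matrix (Fin n) (Fin p) ℝ) (i : ℕ) : ℕ :=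
  ctrbRank A B i - ctrbRank A B (i - 1)

/-- The coordinates that belong to the `i`-th block of the staircase form, `i ≥ 1`: counted from
zero, those in `[rank C_{i-1}, rank C_i)`. -/
abbrev Block {n p : ℕ} (A : Matrix (Fin n) (Fin n) ℝ) (B : Matrix (Fin n) (Fin p) ℝ) (i : ℕ) :
    Type :=
  {a : Fin n // ctrbRank A B (i - 1) ≤ (a : ℕ) ∧ (a : ℕ) < ctrbRank A B i}

/-- The orthogonal matrix `U` brings `(A,B)` to staircase (block Hessenberg) form: only the first
block row of `U'B` is nonzero, and in the `j`-th block column of `U'AU` all block rows after the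
`(j+1)`-st vanish. -/
structure IsStaircase {n p : ℕ} (A : Matrix (Fin n) (Fin n) ℝ) (B : Matrix (Fin n) (Fin p) ℝ)
    (U : Matrix (Fin n) (Fin n) ℝ) : Prop where
  transpose_mul : Uᵀ * U = 1
  mul_transpose : U * Uᵀ = 1
  input_zero : ∀ (a : Fin n) (q : Fin p), ctrbRank A B 1 ≤ (a : ℕ) → (Uᵀ * B) a q = 0
  state_zero : ∀ (j : ℕ) (a b : Fin n), (b : ℕ) < ctrbRank A B j → ctrbRank A B (j + 1) ≤ (a : ℕ) →
    (Uᵀ * A * U) a b = 0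

/-- The input block `B_1` of the staircase form given by `U`. -/
def inputBlock {n p : ℕ} (A : Matrix (Fin n) (Fin n) ℝ) (B : Matrix (Fin n) (Fin p) ℝ)
    (U : Matrix (Fin n) (Fin n) ℝ) : Matrix (Block A B 1) (Fin p) ℝ :=
  (Uᵀ * B).submatrix Subtype.val id

/-- The block `A_{i,j}` of the staircase form given by `U`. -/
def stateBlock {n p : ℕ} (A : Matrix (Fin n) (Fin n) ℝ) (B : Matrix (Fin n) (Fin p) ℝ)
    (U : Matrix (Fin n) (Fin n) ℝ) (i j : ℕ) : Matrix (Block A B i) (Block A B j) ℝ :=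
  (Uᵀ * A * U).submatrix Subtype.val Subtype.val

/-- `(A,B)` is `μ`-robustly coupled: `μ > 0`, and in a staircase form of the pair
`σ_p(B_1) ≥ μ` and `σ_{p_{i+1}}(A_{i+1,i}) ≥ μ` for `1 ≤ i ≤ κ - 1`. (A staircase form is unique up
to orthogonal changes of basis inside the blocks, so these singular values do not depend on `U`.) -/
def RobustlyCoupled {n p : ℕ} (μ : ℝ) (A : Matrix (Fin n) (Fin n) ℝ)
    (B : Matrix (Fin n) (Fin p) ℝ) : Prop :=
  0 < μ ∧ ∃ U : Matrix (Fin n) (Fin n) ℝ, IsStaircase A B U ∧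
    μ ≤ singularValue p (inputBlock A B U) ∧
    ∀ i : ℕ, 1 ≤ i → i < ctrbIndex A B →
      μ ≤ singularValue (blockSize A B (i + 1)) (stateBlock A B U (i + 1) i)

/-- `P` solves the discrete algebraic Riccati equation
`P = A'PA + Q - A'PB (B'PB + R)⁻¹ B'PA`. -/
def IsRiccatiSolution {n p : ℕ} (A : Matrix (Fin n) (Fin n) ℝ) (B : Matrix (Fin n) (Fin p) ℝ)
    (Q : Matrix (Fin n) (Fin n) ℝ) (R : Matrix (Fin p) (Fin p) ℝ)
    (P : Matrix (Fin n) (Fin n) ℝ) : Prop :=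
  P = Aᵀ * P * A + Q - Aᵀ * P * B * (Bᵀ * P * B + R)⁻¹ * Bᵀ * P * A

/-- The gain `K = -(B'PB + R)⁻¹ B'PA`. -/
def lqrGain {n p : ℕ} (A : Matrix (Fin n) (Fin n) ℝ) (B : Matrix (Fin n) (Fin p) ℝ)
    (R : Matrix (Fin p) (Fin p) ℝ) (P : Matrix (Fin n) (Fin n) ℝ) : Matrix (Fin p) (Fin n) ℝ :=
  -((Bᵀ * P * B + R)⁻¹ * Bᵀ * P * A)

/-- A real matrix, seen as a complex one. -/
def toComplex {n : ℕ} (X : Matrix (Fin n) (Fin n) ℝ) : Matrix (Fin n) (Fin n) ℂ :=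
  X.map (fun t : ℝ => (t : ℂ))

/-- The spectral radius `ρ(X)`: the largest modulus of a complex eigenvalue. -/
def specRadius {n : ℕ} (X : Matrix (Fin n) (Fin n) ℝ) : ℝ :=
  (spectralRadius ℂ (toComplex X)).toReal

/-- The `H_∞` norm `sup_{|z| = 1} ‖(zI - X)⁻¹‖₂` of the transfer matrix `(zI - X)⁻¹` of a matrix
`X` with `ρ(X) < 1`, as an extended nonnegative number. -/
def hInfNorm {n : ℕ} (X : Matrix (Fin n) (Fin n) ℝ) : ℝ≥0∞ :=
  ⨆ z : {z : ℂ // ‖z‖ = 1},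
    ENNReal.ofReal ‖((z : ℂ) • (1 : Matrix (Fin n) (Fin n) ℂ) - toComplex X)⁻¹‖

end LQR

end

/-!
The smallest singular values of the staircase blocks bound the cost of steering: each block can be
inverted on its range with norm at most `1 / μ`, so every state is reached in `κ` steps by inputs
of total norm at most `(3 M / μ) ^ κ` times its own. Steering `x` to the origin in this way and
completing the square in the Riccati equation bounds `x' P x` by the cost spent, whence `P ≤ β`
with `β` polynomial in `(3 M ^ 2 / μ) ^ κ`, `M ^ κ` and `κ`.

The closed-loop matrix `X` satisfies the Stein inequality `X' P X + I ≤ P`. Hence `x' P x` shrinks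
along `X` by the factor `1 - 1 / β` at least, which bounds the spectral radius, and testing the
inequality against `(z - X)⁻¹ v` on the unit circle bounds the resolvent by `2 ‖P‖`.

The constant `3 ^ κ` is absorbed by a power of `(M q) ^ κ`, where `q = c M / μ` or `q = M / μ`;
this is possible because `1 < c ≤ M q`, and `m` with `3 ≤ c ^ m` depends on `c` only.
-/

namespace LQR

section SingularValues

open Module

variable {𝕜 E F : Type*} [RCLike 𝕜]
  [NormedAddCommGroup E] [InnerProductSpace 𝕜 E] [FiniteDimensional 𝕜 E]
  [NormedAddCommGroup F] [InnerProductSpace 𝕜 F] [FiniteDimensional 𝕜 F] (L : E →ₗ[𝕜] F)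

/-- The right singular vectors of `L`: an orthonormal eigenbasis of `L† ∘ L`, in the order of
decreasing singular values. -/
noncomputable def rightSingularBasis : OrthonormalBasis (Fin (finrank 𝕜 E)) 𝕜 E :=
  L.isSymmetric_adjoint_comp_self.eigenvectorBasis rfl

theorem norm_map_sq_eq_sum_singularValues (v : E) :
    ‖L v‖ ^ 2 = ∑ i : Fin (finrank 𝕜 E),
      L.singularValues i ^ 2 * ‖inner 𝕜 (rightSingularBasis L i) v‖ ^ 2 := by
  have hcoord (i : Fin (finrank 𝕜 E)) : inner 𝕜 (rightSingularBasis L i) ((L.adjoint ∘ₗ L) v) =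
      (L.singularValues i ^ 2 : ℝ) * inner 𝕜 (rightSingularBasis L i) v := by
    rw [L.sq_singularValues_fin rfl, ← OrthonormalBasis.repr_apply_apply,
      ← OrthonormalBasis.repr_apply_apply, rightSingularBasis,
      LinearMap.IsSymmetric.eigenvectorBasis_apply_self_apply]
  have hsum : (‖L v‖ ^ 2 : 𝕜) = ∑ i, inner 𝕜 v (rightSingularBasis L i) *
      inner 𝕜 (rightSingularBasis L i) ((L.adjoint ∘ₗ L) v) := by
    rw [OrthonormalBasis.sum_inner_mul_inner, LinearMap.comp_apply, LinearMap.adjoint_inner_right,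
      inner_self_eq_norm_sq_to_K]
  have hterm (i : Fin (finrank 𝕜 E)) : inner 𝕜 v (rightSingularBasis L i) *
      inner 𝕜 (rightSingularBasis L i) ((L.adjoint ∘ₗ L) v) =
      ((L.singularValues i ^ 2 * ‖inner 𝕜 (rightSingularBasis L i) v‖ ^ 2 : ℝ) : 𝕜) := by
    rw [hcoord, mul_left_comm, ← inner_conj_symm, RCLike.conj_mul]
    push_cast
    rfl
  simp only [hterm] at hsum
  exact_mod_cast hsum

theorem norm_map_rightSingularBasis (i : Fin (finrank 𝕜 E)) :
    ‖L (rightSingularBasis L i)‖ = L.singularValues i := by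
  rw [← sq_eq_sq₀ (norm_nonneg _) (L.singularValues_nonneg i), norm_map_sq_eq_sum_singularValues,
    Finset.sum_eq_single i]
  · simp
  · intro j _ hji
    simp [(rightSingularBasis L).inner_eq_zero hji]
  · simp

variable {L}

theorem singularValues_le_of_norm_map_le {M : ℝ} (hM : 0 ≤ M) (hL : ∀ v, ‖L v‖ ≤ M * ‖v‖) (i : ℕ) :
    L.singularValues i ≤ M := by
  rcases le_or_gt (finrank 𝕜 E) i with hi | hi
  · exact (L.singularValues_of_finrank_le hi).trans_le hM
  · simpa [norm_map_rightSingularBasis] using hL (rightSingularBasis L ⟨i, hi⟩)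

theorem mul_norm_le_norm_map_of_mem_ker_orthogonal {μ : ℝ} (hμ : 0 ≤ μ)
    (hσ : μ ≤ L.singularValues (finrank 𝕜 L.range - 1)) {v : E} (hv : v ∈ L.kerᗮ) :
    μ * ‖v‖ ≤ ‖L v‖ := by
  refine le_of_sq_le_sq ?_ (norm_nonneg _)
  rw [mul_pow, ← (rightSingularBasis L).sum_sq_norm_inner_right v, Finset.mul_sum,
    norm_map_sq_eq_sum_singularValues]
  refine Finset.sum_le_sum fun i _ => ?_
  rcases lt_or_ge (i : ℕ) (finrank 𝕜 L.range) with hi | hi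
  · have := hσ.trans (L.singularValues_antitone (Nat.le_sub_one_of_lt hi))
    gcongr
  · have hker : rightSingularBasis L i ∈ L.ker := by
      rw [LinearMap.mem_ker, ← norm_eq_zero, norm_map_rightSingularBasis,
        L.singularValues_eq_zero_iff_le_finrank_range.2 hi]
    simp [Submodule.inner_right_of_mem_orthogonal hker hv]

theorem exists_map_eq_of_le_singularValues {μ : ℝ} (hμ : 0 < μ)
    (hσ : μ ≤ L.singularValues (finrank 𝕜 F - 1)) (w : F) :
    ∃ v, L v = w ∧ μ * ‖v‖ ≤ ‖w‖ := by
  have hrank : finrank 𝕜 L.range = finrank 𝕜 F := by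
    have := L.singularValues_pos_iff_lt_finrank_range.1 (hμ.trans_le hσ)
    have := L.range.finrank_le
    omega
  obtain ⟨v, rfl⟩ := LinearMap.range_eq_top.1 (Submodule.eq_top_of_finrank_eq hrank) w
  obtain ⟨x, hx, y, hy, rfl⟩ := L.ker.exists_add_mem_mem_orthogonal v
  have hxy : L (x + y) = L y := by rw [map_add, LinearMap.mem_ker.1 hx, zero_add]
  rw [hxy]
  exact ⟨y, rfl, mul_norm_le_norm_map_of_mem_ker_orthogonal hμ.le (hrank ▸ hσ) hy⟩

end SingularValues

section Steering

variable {R E F : Type*} [Semiring R] [SeminormedAddCommGroup E] [Module R E]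
  [SeminormedAddCommGroup F] [Module R F] {A : E →ₗ[R] E} {B : F →ₗ[R] E} {M : ℝ}

/-- The state reached from the origin after `k` steps of `x ↦ A x + B u`. The inputs are indexed
backwards in time: `u j` is the one applied `j` steps before the last. -/
def inputResponse (A : E →ₗ[R] E) (B : F →ₗ[R] E) {k : ℕ} (u : Fin k → F) : E :=
  ∑ j : Fin k, (A ^ (j : ℕ)) (B (u j))

theorem inputResponse_add {k : ℕ} (u u' : Fin k → F) :
    inputResponse A B (u + u') = inputResponse A B u + inputResponse A B u' := by
  simp [inputResponse, Finset.sum_add_distrib]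

theorem inputResponse_cons {k : ℕ} (a : F) (u : Fin k → F) :
    inputResponse A B (Fin.cons a u : Fin (k + 1) → F) = B a + A (inputResponse A B u) := by
  simp [inputResponse, Fin.sum_univ_succ, pow_succ']

theorem inputResponse_snoc {k : ℕ} (u : Fin k → F) (a : F) :
    inputResponse A B (Fin.snoc u a : Fin (k + 1) → F) = inputResponse A B u + (A ^ k) (B a) := by
  simp [inputResponse, Fin.sum_univ_castSucc]

theorem norm_pow_apply_le (hM : 0 ≤ M) (hA : ∀ x, ‖A x‖ ≤ M * ‖x‖) (k : ℕ) (x : E) :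
    ‖(A ^ k) x‖ ≤ M ^ k * ‖x‖ := by
  induction k with
  | zero => simp
  | succ k ih =>
    calc ‖(A ^ (k + 1)) x‖ ≤ M * ‖(A ^ k) x‖ := by
          rw [pow_succ', Module.End.mul_apply]
          exact hA _
      _ ≤ M * (M ^ k * ‖x‖) := by gcongr
      _ = M ^ (k + 1) * ‖x‖ := by ring

theorem exists_inputResponse_eq_map_add {k : ℕ} (u u' : Fin k → F) :
    ∃ u'' : Fin (k + 1) → F,
      inputResponse A B u'' = A (inputResponse A B u) + inputResponse A B u' ∧
        ∑ j, ‖u'' j‖ ≤ ∑ j, ‖u j‖ + ∑ j, ‖u' j‖ := by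
  let delayed : Fin (k + 1) → F := Fin.cons 0 u
  let extended : Fin (k + 1) → F := Fin.snoc u' 0
  have hdelayed : ∑ j, ‖delayed j‖ = ∑ j, ‖u j‖ := by simp [delayed, Fin.sum_univ_succ]
  have hextended : ∑ j, ‖extended j‖ = ∑ j, ‖u' j‖ := by simp [extended, Fin.sum_univ_castSucc]
  refine ⟨delayed + extended, ?_, ?_⟩
  · simp [inputResponse_add, delayed, extended, inputResponse_cons, inputResponse_snoc]
  · rw [← hdelayed, ← hextended, ← Finset.sum_add_distrib]
    exact Finset.sum_le_sum fun j _ => norm_add_le _ _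

theorem norm_add_norm_sub_apply_le {μ : ℝ} (hM : 1 ≤ M) (hμ : 0 < μ) (hμM : μ ≤ M)
    (hA : ∀ x, ‖A x‖ ≤ M * ‖x‖) {v w : E} (hvw : μ * ‖v‖ ≤ ‖w‖) :
    ‖v‖ + ‖w - A v‖ ≤ 3 * (M / μ) * ‖w‖ := by
  have hv : ‖v‖ ≤ ‖w‖ / μ := (le_div_iff₀' hμ).2 hvw
  calc ‖v‖ + ‖w - A v‖ ≤ ‖v‖ + (‖w‖ + M * ‖v‖) := by
        gcongr
        exact (norm_sub_le _ _).trans (by gcongr; exact hA v)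
    _ ≤ M * (‖w‖ / μ) + (M / μ * ‖w‖ + M * (‖w‖ / μ)) := by
        gcongr
        · exact hv.trans (le_mul_of_one_le_left (by positivity) hM)
        · exact le_mul_of_one_le_left (norm_nonneg w) ((one_le_div hμ).2 hμM)
    _ = 3 * (M / μ) * ‖w‖ := by ring

theorem exists_inputResponse_eq {S : ℕ → Set E} {k : ℕ} {μ : ℝ} (hM : 1 ≤ M) (hμ : 0 < μ)
    (hμM : μ ≤ M) (hA : ∀ x, ‖A x‖ ≤ M * ‖x‖)
    (hB : ∀ w ∈ S 1, ∃ u, B u = w ∧ μ * ‖u‖ ≤ ‖w‖)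
    (hS : ∀ i, 1 ≤ i → i < k → ∀ w ∈ S (i + 1), ∃ v ∈ S i, w - A v ∈ S i ∧ μ * ‖v‖ ≤ ‖w‖)
    (hk : 1 ≤ k) :
    ∀ w ∈ S k, ∃ u : Fin k → F, inputResponse A B u = w ∧
      ∑ j, ‖u j‖ ≤ (3 * (M / μ)) ^ k * ‖w‖ := by
  induction k, hk using Nat.le_induction with
  | base =>
    intro w hw
    obtain ⟨u, rfl, hu⟩ := hB w hw
    refine ⟨fun _ => u, by simp [inputResponse], ?_⟩
    calc ∑ _ : Fin 1, ‖u‖ = ‖u‖ := by simp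
      _ ≤ 1 / μ * ‖B u‖ := by rwa [one_div, ← div_eq_inv_mul, le_div_iff₀' hμ]
      _ ≤ (3 * (M / μ)) ^ 1 * ‖B u‖ := by
        rw [pow_one, ← mul_div_assoc]
        gcongr
        linarith
  | succ i hi ih =>
    intro w hw
    obtain ⟨v, hv, hwv, hvw⟩ := hS i hi i.lt_succ_self w hw
    have hreach := ih fun j hj hji => hS j hj (hji.trans i.lt_succ_self)
    obtain ⟨u, hu, hu_sum⟩ := hreach v hv
    obtain ⟨u', hu', hu'_sum⟩ := hreach (w - A v) hwv
    obtain ⟨u'', hu'', hu''_sum⟩ := exists_inputResponse_eq_map_add (A := A) (B := B) u u'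
    refine ⟨u'', by rw [hu'', hu, hu', add_sub_cancel], ?_⟩
    have hpair := norm_add_norm_sub_apply_le hM hμ hμM hA hvw
    calc ∑ j, ‖u'' j‖ ≤ ∑ j, ‖u j‖ + ∑ j, ‖u' j‖ := hu''_sum
      _ ≤ (3 * (M / μ)) ^ i * ‖v‖ + (3 * (M / μ)) ^ i * ‖w - A v‖ := add_le_add hu_sum hu'_sum
      _ = (3 * (M / μ)) ^ i * (‖v‖ + ‖w - A v‖) := by ring
      _ ≤ (3 * (M / μ)) ^ i * (3 * (M / μ) * ‖w‖) := by gcongr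
      _ = (3 * (M / μ)) ^ (i + 1) * ‖w‖ := by ring

theorem le_of_pow_apply_add_inputResponse_eq_zero {V : E → ℝ} (hM : 1 ≤ M)
    (hA : ∀ x, ‖A x‖ ≤ M * ‖x‖) (hB : ∀ u, ‖B u‖ ≤ M * ‖u‖) (hV₀ : V 0 ≤ 0)
    (hV : ∀ x u, V x ≤ ‖x‖ ^ 2 + ‖u‖ ^ 2 + V (A x + B u)) {k : ℕ} {x : E} {u : Fin k → F}
    (hxu : (A ^ k) x + inputResponse A B u = 0) :
    V x ≤ k * (M ^ k) ^ 2 * (‖x‖ + ∑ j, ‖u j‖) ^ 2 := by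
  induction k generalizing x with
  | zero =>
    obtain rfl : x = 0 := by simpa [inputResponse] using hxu
    simpa using hV₀
  | succ k ih =>
    obtain ⟨v, a, rfl⟩ : ∃ v a, u = (Fin.snoc v a : Fin (k + 1) → F) :=
      ⟨_, _, (Fin.snoc_init_self u).symm⟩
    have hsum : ∑ j, ‖(Fin.snoc v a : Fin (k + 1) → F) j‖ = ∑ j, ‖v j‖ + ‖a‖ := by
      simp [Fin.sum_univ_castSucc]
    have hnext : (A ^ k) (A x + B a) + inputResponse A B v = 0 := by
      rw [← hxu, inputResponse_snoc, map_add, pow_succ, Module.End.mul_apply]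
      abel
    set N := ‖x‖ + (∑ j, ‖v j‖ + ‖a‖) with hN
    have hv : 0 ≤ ∑ j, ‖v j‖ := by positivity
    have hbudget : ‖A x + B a‖ + ∑ j, ‖v j‖ ≤ M * N := by
      calc ‖A x + B a‖ + ∑ j, ‖v j‖ ≤ (M * ‖x‖ + M * ‖a‖) + M * ∑ j, ‖v j‖ :=
            add_le_add ((norm_add_le _ _).trans (add_le_add (hA x) (hB a)))
              (le_mul_of_one_le_left hv hM)
        _ = M * N := by ring
    have hstage : ‖x‖ ^ 2 + ‖a‖ ^ 2 ≤ (M ^ (k + 1)) ^ 2 * N ^ 2 := by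
      calc ‖x‖ ^ 2 + ‖a‖ ^ 2 ≤ (‖x‖ + ‖a‖) ^ 2 := by
            linarith [mul_nonneg (norm_nonneg x) (norm_nonneg a),
              add_sq ‖x‖ ‖a‖]
        _ ≤ N ^ 2 := by gcongr; linarith
        _ ≤ (M ^ (k + 1)) ^ 2 * N ^ 2 :=
          le_mul_of_one_le_left (sq_nonneg N) (one_le_pow₀ (one_le_pow₀ hM))
    rw [hsum, ← hN]
    calc V x ≤ ‖x‖ ^ 2 + ‖a‖ ^ 2 + V (A x + B a) := hV x a
      _ ≤ (M ^ (k + 1)) ^ 2 * N ^ 2 + k * (M ^ k) ^ 2 * (M * N) ^ 2 :=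
        add_le_add hstage ((ih hnext).trans (by gcongr))
      _ = (k + 1 : ℕ) * (M ^ (k + 1)) ^ 2 * N ^ 2 := by
        push_cast
        ring

theorem le_mul_norm_sq_of_exists_inputResponse_eq {V : E → ℝ} (hM : 1 ≤ M)
    (hA : ∀ x, ‖A x‖ ≤ M * ‖x‖) (hB : ∀ u, ‖B u‖ ≤ M * ‖u‖) (hV₀ : V 0 ≤ 0)
    (hV : ∀ x u, V x ≤ ‖x‖ ^ 2 + ‖u‖ ^ 2 + V (A x + B u)) {k : ℕ} {γ : ℝ} (hγ : 0 ≤ γ)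
    (hreach : ∀ w, ∃ u : Fin k → F, inputResponse A B u = w ∧ ∑ j, ‖u j‖ ≤ γ ^ k * ‖w‖) (x : E) :
    V x ≤ k * (M ^ k) ^ 2 * (1 + (γ * M) ^ k) ^ 2 * ‖x‖ ^ 2 := by
  obtain ⟨u, hu, hu_sum⟩ := hreach (-(A ^ k) x)
  rw [norm_neg] at hu_sum
  have hbudget : ‖x‖ + ∑ j, ‖u j‖ ≤ (1 + (γ * M) ^ k) * ‖x‖ := by
    calc ‖x‖ + ∑ j, ‖u j‖ ≤ ‖x‖ + γ ^ k * ‖(A ^ k) x‖ := by gcongr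
      _ ≤ ‖x‖ + γ ^ k * (M ^ k * ‖x‖) := by
        gcongr
        exact norm_pow_apply_le (by linarith) hA k x
      _ = (1 + (γ * M) ^ k) * ‖x‖ := by rw [mul_pow]; ring
  calc V x ≤ k * (M ^ k) ^ 2 * (‖x‖ + ∑ j, ‖u j‖) ^ 2 :=
        le_of_pow_apply_add_inputResponse_eq_zero hM hA hB hV₀ hV (by rw [hu, add_neg_cancel])
    _ ≤ k * (M ^ k) ^ 2 * ((1 + (γ * M) ^ k) * ‖x‖) ^ 2 := by gcongr
    _ = k * (M ^ k) ^ 2 * (1 + (γ * M) ^ k) ^ 2 * ‖x‖ ^ 2 := by ring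

end Steering

section Coordinates

variable {𝕜 ι κ : Type*} [RCLike 𝕜] [Fintype ι] [Fintype κ] {f : ι → κ}

theorem norm_toLp_extend (hf : f.Injective) (v : ι → 𝕜) :
    ‖WithLp.toLp 2 (Function.extend f v 0)‖ = ‖WithLp.toLp 2 v‖ := by
  rw [EuclideanSpace.norm_eq, EuclideanSpace.norm_eq]
  congr 1
  refine (Fintype.sum_of_injective f hf _ _ (fun j hj => ?_) fun i => ?_).symm
  · simp [Function.extend_apply' _ _ _ hj]
  · simp [hf.extend_apply]

theorem norm_toLp_comp_le (hf : f.Injective) (v : κ → 𝕜) :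
    ‖WithLp.toLp 2 (v ∘ f)‖ ≤ ‖WithLp.toLp 2 v‖ := by
  rw [EuclideanSpace.norm_eq, EuclideanSpace.norm_eq]
  gcongr
  calc ∑ i, ‖v (f i)‖ ^ 2 = ∑ j ∈ Finset.univ.map ⟨f, hf⟩, ‖v j‖ ^ 2 := by rw [Finset.sum_map]; rfl
    _ ≤ ∑ j, ‖v j‖ ^ 2 := Finset.sum_le_univ_sum_of_nonneg fun _ => by positivity

theorem mulVec_extend {l R : Type*} [NonUnitalNonAssocSemiring R] (hf : f.Injective)
    (X : Matrix l κ R) (v : ι → R) : X *ᵥ Function.extend f v 0 = X.submatrix id f *ᵥ v := by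
  ext a
  refine (Fintype.sum_of_injective f hf _ _ (fun j hj => ?_) fun i => ?_).symm
  · simp [Function.extend_apply' _ _ _ hj]
  · simp [hf.extend_apply]

theorem norm_toEuclideanLin_apply_le [DecidableEq ι] {X : Matrix κ ι 𝕜} {M : ℝ} (hX : ‖X‖ ≤ M)
    (v : EuclideanSpace 𝕜 ι) : ‖X.toEuclideanLin v‖ ≤ M * ‖v‖ :=
  (X.l2_opNorm_mulVec v).trans (by gcongr)

theorem norm_toEuclideanLin_apply_of_conjTranspose_mul_self [DecidableEq ι] {U : Matrix κ ι 𝕜}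
    (hU : Uᴴ * U = 1) (v : EuclideanSpace 𝕜 ι) : ‖U.toEuclideanLin v‖ = ‖v‖ := by
  classical
  refine (LinearMap.norm_map_iff_inner_map_map U.toEuclideanLin).2 (fun x y => ?_) v
  rw [← LinearMap.adjoint_inner_left, ← Matrix.toEuclideanLin_conjTranspose_eq_adjoint]
  simp [Matrix.toLpLin_apply, Matrix.mulVec_mulVec, hU]

theorem exists_toEuclideanLin_eq_of_le_singularValue [DecidableEq ι] [DecidableEq κ]
    {X : Matrix κ ι ℝ} {μ : ℝ} {k : ℕ} (hμ : 0 < μ) (hk : Fintype.card κ ≤ k)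
    (hσ : μ ≤ singularValue k X) (w : EuclideanSpace ℝ κ) :
    ∃ v, X.toEuclideanLin v = w ∧ μ * ‖v‖ ≤ ‖w‖ := by
  refine exists_map_eq_of_le_singularValues hμ (hσ.trans (LinearMap.singularValues_antitone _ ?_)) w
  rw [finrank_euclideanSpace]
  omega

end Coordinates

section Staircase

variable {n p : ℕ} {A : Matrix (Fin n) (Fin n) ℝ} {B : Matrix (Fin n) (Fin p) ℝ}
  {U : Matrix (Fin n) (Fin n) ℝ} {M μ : ℝ}

theorem ctrbRank_le_mul (A : Matrix (Fin n) (Fin n) ℝ) (B : Matrix (Fin n) (Fin p) ℝ) (k : ℕ) :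
    ctrbRank A B k ≤ k * p := by
  simpa [ctrbRank] using (ctrbMatrix A B k).rank_le_card_width

theorem ctrbRank_le (A : Matrix (Fin n) (Fin n) ℝ) (B : Matrix (Fin n) (Fin p) ℝ) (k : ℕ) :
    ctrbRank A B k ≤ n := by
  simpa [ctrbRank] using (ctrbMatrix A B k).rank_le_card_height

theorem card_block_le (A : Matrix (Fin n) (Fin n) ℝ) (B : Matrix (Fin n) (Fin p) ℝ) (i : ℕ) :
    Fintype.card (Block A B i) ≤ blockSize A B i := by
  refine le_of_le_of_eq ?_ (Nat.card_Ico (ctrbRank A B (i - 1)) (ctrbRank A B i))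
  exact Finset.card_le_card_of_injOn (fun a => (a : ℕ)) (by grind [Set.MapsTo])
    fun a _ b _ hab => Subtype.ext (Fin.ext hab)

theorem Controllable.ctrbIndex_mem (hctrb : Controllable A B) :
    1 ≤ ctrbIndex A B ∧ ctrbRank A B (ctrbIndex A B) = n := by
  refine Nat.sInf_mem (s := {k | 1 ≤ k ∧ ctrbRank A B k = n}) ?_
  obtain ⟨k, -, hk⟩ := hctrb
  rcases Nat.eq_zero_or_pos k with rfl | hk_pos
  · have hn : n = 0 := by simpa [hk] using ctrbRank_le_mul A B 0
    exact ⟨1, le_rfl, by have := ctrbRank_le A B 1; omega⟩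
  · exact ⟨k, hk_pos, hk⟩

/-- The span of the first `i` blocks of the orthonormal basis formed by the columns of `U`, in
which `(A, B)` has staircase form. -/
def stairSpace (A : Matrix (Fin n) (Fin n) ℝ) (B : Matrix (Fin n) (Fin p) ℝ)
    (U : Matrix (Fin n) (Fin n) ℝ) (i : ℕ) : Set (EuclideanSpace ℝ (Fin n)) :=
  {x | ∀ a : Fin n, ctrbRank A B i ≤ a → (Uᵀ *ᵥ x.ofLp) a = 0}

theorem Controllable.stairSpace_ctrbIndex (hctrb : Controllable A B) :
    stairSpace A B U (ctrbIndex A B) = Set.univ :=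
  Set.eq_univ_of_forall fun _ a ha => absurd a.isLt (hctrb.ctrbIndex_mem.2 ▸ ha).not_gt

theorem IsStaircase.norm_transpose_apply (hU : IsStaircase A B U) (x : EuclideanSpace ℝ (Fin n)) :
    ‖Uᵀ.toEuclideanLin x‖ = ‖x‖ :=
  norm_toEuclideanLin_apply_of_conjTranspose_mul_self (by simpa using hU.mul_transpose) x

theorem IsStaircase.norm_apply (hU : IsStaircase A B U) (x : EuclideanSpace ℝ (Fin n)) :
    ‖U.toEuclideanLin x‖ = ‖x‖ :=
  norm_toEuclideanLin_apply_of_conjTranspose_mul_self (by simpa using hU.transpose_mul) x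

theorem IsStaircase.le_of_le_singularValue_inputBlock (hU : IsStaircase A B U) (hB : ‖B‖ ≤ M)
    {k : ℕ} (hσ : μ ≤ singularValue k (inputBlock A B U)) : μ ≤ M := by
  refine hσ.trans (singularValues_le_of_norm_map_le ((norm_nonneg B).trans hB) (fun u => ?_) _)
  have hblock : (inputBlock A B U).toEuclideanLin u =
      WithLp.toLp 2 ((Uᵀ *ᵥ B *ᵥ u.ofLp) ∘ Subtype.val) := by
    rw [Matrix.mulVec_mulVec]
    rfl
  calc ‖(inputBlock A B U).toEuclideanLin u‖ ≤ ‖Uᵀ.toEuclideanLin (B.toEuclideanLin u)‖ :=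
        hblock ▸ norm_toLp_comp_le Subtype.val_injective _
    _ = ‖B.toEuclideanLin u‖ := hU.norm_transpose_apply _
    _ ≤ M * ‖u‖ := norm_toEuclideanLin_apply_le hB u

theorem IsStaircase.exists_input_eq_of_mem_stairSpace (hU : IsStaircase A B U) (hμ : 0 < μ)
    (hσ : μ ≤ singularValue p (inputBlock A B U)) {w : EuclideanSpace ℝ (Fin n)}
    (hw : w ∈ stairSpace A B U 1) :
    ∃ u, B.toEuclideanLin u = w ∧ μ * ‖u‖ ≤ ‖w‖ := by
  have hcard : Fintype.card (Block A B 1) ≤ p :=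
    (card_block_le A B 1).trans ((Nat.sub_le _ _).trans (by simpa using ctrbRank_le_mul A B 1))
  obtain ⟨u, hu, hu_norm⟩ := exists_toEuclideanLin_eq_of_le_singularValue hμ hcard hσ
    (WithLp.toLp 2 ((Uᵀ *ᵥ w.ofLp) ∘ Subtype.val))
  refine ⟨u, ?_, hu_norm.trans <| (norm_toLp_comp_le Subtype.val_injective _).trans_eq
    (hU.norm_transpose_apply w)⟩
  have hcoord : Uᵀ *ᵥ B *ᵥ u.ofLp = Uᵀ *ᵥ w.ofLp := by
    ext a
    rw [Matrix.mulVec_mulVec]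
    rcases le_or_gt (ctrbRank A B 1) a with ha | ha
    · rw [hw a ha]
      simp [Matrix.mulVec, dotProduct, hU.input_zero a _ ha]
    · have h₀ : ctrbRank A B (1 - 1) ≤ a := by simpa using ctrbRank_le_mul A B 0 |>.trans (by simp)
      exact congrFun (congrArg WithLp.ofLp hu) ⟨a, h₀, ha⟩
  have hUcoord := congrArg (U *ᵥ ·) hcoord
  simp only [Matrix.mulVec_mulVec, ← Matrix.mul_assoc, hU.mul_transpose, Matrix.one_mul,
    Matrix.one_mulVec] at hUcoord
  exact congrArg (WithLp.toLp 2) hUcoord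

theorem IsStaircase.exists_predecessor_of_mem_stairSpace (hU : IsStaircase A B U) (hμ : 0 < μ)
    {i : ℕ} (hσ : μ ≤ singularValue (blockSize A B (i + 1)) (stateBlock A B U (i + 1) i))
    {w : EuclideanSpace ℝ (Fin n)} (hw : w ∈ stairSpace A B U (i + 1)) :
    ∃ v ∈ stairSpace A B U i, w - A.toEuclideanLin v ∈ stairSpace A B U i ∧ μ * ‖v‖ ≤ ‖w‖ := by
  obtain ⟨y, hy, hy_norm⟩ := exists_toEuclideanLin_eq_of_le_singularValue hμ
    (card_block_le A B (i + 1)) hσ (WithLp.toLp 2 ((Uᵀ *ᵥ w.ofLp) ∘ Subtype.val))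
  set y₀ : Fin n → ℝ := Function.extend Subtype.val y.ofLp 0
  have hUy : Uᵀ *ᵥ U *ᵥ y₀ = y₀ := by simp [Matrix.mulVec_mulVec, hU.transpose_mul]
  have hUA : Uᵀ *ᵥ A *ᵥ U *ᵥ y₀ = (Uᵀ * A * U).submatrix id Subtype.val *ᵥ y.ofLp := by
    rw [← mulVec_extend Subtype.val_injective, Matrix.mulVec_mulVec, Matrix.mulVec_mulVec]
  refine ⟨U.toEuclideanLin (WithLp.toLp 2 y₀), fun a ha => ?_, fun a ha => ?_, ?_⟩
  · have hblock : ¬∃ b : Block A B i, b.1 = a := by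
      rintro ⟨b, rfl⟩
      exact b.2.2.not_ge ha
    exact (congrFun hUy a).trans (Function.extend_apply' _ _ _ hblock)
  · suffices (Uᵀ *ᵥ w.ofLp) a = (Uᵀ *ᵥ A *ᵥ U *ᵥ y₀) a by
      simpa [Matrix.mulVec_sub, sub_eq_zero] using this
    rw [hUA]
    rcases le_or_gt (ctrbRank A B (i + 1)) a with ha' | ha'
    · rw [hw a ha']
      have hrow (b : Block A B i) : (Uᵀ * A * U) a b = 0 := hU.state_zero i a b b.2.2 ha'
      simp [Matrix.mulVec, dotProduct, hrow]
    · exact (congrFun (congrArg WithLp.ofLp hy) ⟨a, ha, ha'⟩).symm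
  · rw [hU.norm_apply, norm_toLp_extend Subtype.val_injective]
    exact hy_norm.trans <| (norm_toLp_comp_le Subtype.val_injective _).trans_eq
      (hU.norm_transpose_apply w)

end Staircase

section Riccati

variable {n p : ℕ} {A : Matrix (Fin n) (Fin n) ℝ} {B : Matrix (Fin n) (Fin p) ℝ}
  {Q P : Matrix (Fin n) (Fin n) ℝ} {R : Matrix (Fin p) (Fin p) ℝ}

theorem mul_lqrGain (hG : IsUnit (Bᵀ * P * B + R)) :
    (Bᵀ * P * B + R) * lqrGain A B R P = -(Bᵀ * P * A) := by
  have hdet := (Matrix.isUnit_iff_isUnit_det _).1 hG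
  simp only [lqrGain, Matrix.mul_neg, Matrix.mul_assoc _ _ A, Matrix.mul_assoc _ Bᵀ,
    Matrix.mul_nonsing_inv_cancel_left _ _ hdet]

theorem dotProduct_mulVec_comm_of_isSymm {ι S : Type*} [Fintype ι] [CommSemiring S]
    {X : Matrix ι ι S} (hX : X.IsSymm) (v w : ι → S) : v ⬝ᵥ X *ᵥ w = w ⬝ᵥ X *ᵥ v := by
  rw [← X.dotProduct_transpose_mulVec, hX.eq]

theorem IsRiccatiSolution.eq_add_mul_lqrGain (hP : IsRiccatiSolution A B Q R P) :
    P = Aᵀ * P * A + Q + Aᵀ * P * B * lqrGain A B R P := by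
  conv_lhs => rw [hP]
  simp only [lqrGain, Matrix.mul_neg, Matrix.mul_assoc, sub_eq_add_neg]

theorem IsRiccatiSolution.completion_of_squares (hP : IsRiccatiSolution A B Q R P)
    (hPt : P.IsSymm) (hRt : R.IsSymm) (hG : IsUnit (Bᵀ * P * B + R)) (x : Fin n → ℝ)
    (u : Fin p → ℝ) :
    x ⬝ᵥ P *ᵥ x +
        (u - lqrGain A B R P *ᵥ x) ⬝ᵥ (Bᵀ * P * B + R) *ᵥ (u - lqrGain A B R P *ᵥ x) =
      x ⬝ᵥ Q *ᵥ x + u ⬝ᵥ R *ᵥ u + (A *ᵥ x + B *ᵥ u) ⬝ᵥ P *ᵥ (A *ᵥ x + B *ᵥ u) := by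
  set G := Bᵀ * P * B + R with hG_def
  set y := lqrGain A B R P *ᵥ x with hy
  have hGt : G.IsSymm := by
    simp [hG_def, Matrix.IsSymm, Matrix.transpose_mul, hPt.eq, hRt.eq, Matrix.mul_assoc]
  have hGy : G *ᵥ y = -(Bᵀ *ᵥ P *ᵥ A *ᵥ x) := by
    rw [hy, Matrix.mulVec_mulVec, mul_lqrGain hG, Matrix.neg_mulVec]
    simp only [Matrix.mulVec_mulVec, Matrix.mul_assoc]
  have hvGy (v : Fin p → ℝ) : v ⬝ᵥ G *ᵥ y = -((A *ᵥ x) ⬝ᵥ P *ᵥ B *ᵥ v) := by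
    rw [hGy, dotProduct_neg, Matrix.dotProduct_transpose_mulVec,
      dotProduct_mulVec_comm_of_isSymm hPt, dotProduct_comm]
  have hxPx : x ⬝ᵥ P *ᵥ x = (A *ᵥ x) ⬝ᵥ P *ᵥ A *ᵥ x + x ⬝ᵥ Q *ᵥ x + (A *ᵥ x) ⬝ᵥ P *ᵥ B *ᵥ y := by
    have h := congrArg (fun X => x ⬝ᵥ X *ᵥ x) hP.eq_add_mul_lqrGain
    simpa only [Matrix.add_mulVec, dotProduct_add, ← Matrix.mulVec_mulVec, Matrix.mul_assoc,
      Matrix.dotProduct_transpose_mulVec, ← hy, dotProduct_comm (P *ᵥ _)] using h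
  have huGu : u ⬝ᵥ G *ᵥ u = (B *ᵥ u) ⬝ᵥ P *ᵥ B *ᵥ u + u ⬝ᵥ R *ᵥ u := by
    simp only [hG_def, Matrix.add_mulVec, dotProduct_add, ← Matrix.mulVec_mulVec,
      Matrix.dotProduct_transpose_mulVec, dotProduct_comm (P *ᵥ _)]
  simp only [Matrix.mulVec_add, Matrix.mulVec_sub, dotProduct_add, dotProduct_sub, add_dotProduct,
    sub_dotProduct]
  rw [dotProduct_mulVec_comm_of_isSymm hGt y u, hvGy, hvGy, hxPx, huGu,
    dotProduct_mulVec_comm_of_isSymm hPt (B *ᵥ u) (A *ᵥ x)]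
  ring

theorem IsRiccatiSolution.closedLoop_lyapunov (hP : IsRiccatiSolution A B Q R P)
    (hG : IsUnit (Bᵀ * P * B + R)) :
    P = (A + B * lqrGain A B R P)ᵀ * P * (A + B * lqrGain A B R P) + Q +
      (lqrGain A B R P)ᵀ * R * lqrGain A B R P := by
  have hcancel : (lqrGain A B R P)ᵀ * (Bᵀ * P * A) +
      (lqrGain A B R P)ᵀ * ((Bᵀ * P * B + R) * lqrGain A B R P) = 0 := by
    rw [mul_lqrGain hG, Matrix.mul_neg, add_neg_cancel]
  conv_lhs => rw [hP.eq_add_mul_lqrGain, ← add_zero (_ + _), ← hcancel]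
  simp only [Matrix.transpose_add, Matrix.transpose_mul, Matrix.mul_add, Matrix.add_mul,
    Matrix.mul_assoc]
  abel

theorem posDef_transpose_mul_mul_add {ι κ : Type*} [Fintype ι] [Finite κ] {P : Matrix ι ι ℝ}
    {R : Matrix κ κ ℝ} (hP₀ : P.PosSemidef) (hR : R.PosDef) (B : Matrix ι κ ℝ) :
    (Bᵀ * P * B + R).PosDef := by
  simpa using Matrix.PosDef.posSemidef_add (hP₀.conjTranspose_mul_mul_same B) hR

theorem IsRiccatiSolution.dotProduct_mulVec_le (hP : IsRiccatiSolution A B Q R P)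
    (hP₀ : P.PosSemidef) (hR : R.PosDef) (x : Fin n → ℝ) (u : Fin p → ℝ) :
    x ⬝ᵥ P *ᵥ x ≤
      x ⬝ᵥ Q *ᵥ x + u ⬝ᵥ R *ᵥ u + (A *ᵥ x + B *ᵥ u) ⬝ᵥ P *ᵥ (A *ᵥ x + B *ᵥ u) := by
  have hG := posDef_transpose_mul_mul_add hP₀ hR B
  rw [← hP.completion_of_squares (by simpa using hP₀.isHermitian) (by simpa using hR.isHermitian)
    hG.isUnit x u]
  exact le_add_of_nonneg_right (hG.posSemidef.dotProduct_mulVec_nonneg _)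

open scoped MatrixOrder in
theorem IsRiccatiSolution.stein_le (hP : IsRiccatiSolution A B Q R P) (hP₀ : P.PosSemidef)
    (hR : R.PosDef) :
    (A + B * lqrGain A B R P)ᵀ * P * (A + B * lqrGain A B R P) + Q ≤ P := by
  conv_rhs => rw [hP.closedLoop_lyapunov (posDef_transpose_mul_mul_add hP₀ hR B).isUnit]
  refine le_add_of_nonneg_right (Matrix.nonneg_iff_posSemidef.2 ?_)
  simpa using hR.posSemidef.conjTranspose_mul_mul_same (lqrGain A B R P)

end Riccati

section Stein

open ComplexConjugate

variable {𝒜 : Type*} [CStarAlgebra 𝒜] [PartialOrder 𝒜] [StarOrderedRing 𝒜] {p x : 𝒜}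

theorem one_le_of_stein (hp : 0 ≤ p) (hx : star x * p * x + 1 ≤ p) : 1 ≤ p :=
  (le_add_of_nonneg_left (star_left_conjugate_nonneg hp x)).trans hx

theorem star_mul_mul_le_smul_of_stein {β : ℝ} (hβ : 0 < β) (hpβ : p ≤ algebraMap ℝ 𝒜 β)
    (hx : star x * p * x + 1 ≤ p) : star x * p * x ≤ (1 - β⁻¹) • p := by
  have hle : β⁻¹ • p ≤ 1 := by
    calc β⁻¹ • p ≤ β⁻¹ • algebraMap ℝ 𝒜 β := smul_le_smul_of_nonneg_left hpβ (by positivity)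
      _ = 1 := by rw [Algebra.algebraMap_eq_smul_one, smul_smul, inv_mul_cancel₀ hβ.ne', one_smul]
  calc star x * p * x ≤ p - 1 := le_sub_iff_add_le.2 hx
    _ ≤ p - β⁻¹ • p := sub_le_sub_left hle p
    _ = (1 - β⁻¹) • p := by rw [sub_smul, one_smul]

theorem norm_sq_le_of_mem_spectrum_of_star_mul_mul_le_smul {θ : ℝ} (hθ : 0 ≤ θ)
    (hp : IsStrictlyPositive p) (hx : star x * p * x ≤ θ • p) {z : ℂ} (hz : z ∈ spectrum ℂ x) :
    ‖z‖ ^ 2 ≤ θ := by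
  have : Nontrivial 𝒜 := by
    by_contra h
    rw [not_nontrivial_iff_subsingleton] at h
    simp at hz
  obtain ⟨_, ⟨b, rfl⟩, rfl⟩ := CStarAlgebra.isStrictlyPositive_iff_eq_star_mul_self.1 hp
  set y : 𝒜 := b * x * ↑b⁻¹ with hy
  have hyy : star y * y ≤ algebraMap ℝ 𝒜 θ := by
    have hconj : star (↑b⁻¹ : 𝒜) * (star x * (star ↑b * ↑b) * x) * ↑b⁻¹ = star y * y := by
      simp only [hy, star_mul]
      noncomm_ring
    have hone : star (↑b⁻¹ : 𝒜) * (θ • (star ↑b * ↑b)) * ↑b⁻¹ = algebraMap ℝ 𝒜 θ := by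
      calc star (↑b⁻¹ : 𝒜) * (θ • (star ↑b * ↑b)) * ↑b⁻¹
          = θ • (star (↑b * ↑b⁻¹ : 𝒜) * (↑b * ↑b⁻¹)) := by
            simp only [star_mul, mul_smul_comm, smul_mul_assoc, mul_assoc]
        _ = algebraMap ℝ 𝒜 θ := by
            rw [b.mul_inv, star_one, mul_one, Algebra.algebraMap_eq_smul_one]
    exact hconj ▸ hone ▸ star_left_conjugate_le_conjugate hx (↑b⁻¹ : 𝒜)
  have hzy : z ∈ spectrum ℂ y := by rwa [hy, spectrum.units_conjugate]
  calc ‖z‖ ^ 2 ≤ ‖y‖ ^ 2 := by gcongr; exact spectrum.norm_le_norm_of_mem hzy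
    _ = ‖star y * y‖ := by rw [CStarRing.norm_star_mul_self, sq]
    _ ≤ θ := (CStarAlgebra.norm_le_iff_le_algebraMap _ hθ (star_mul_self_nonneg y)).2 hyy

theorem norm_sq_le_of_mem_spectrum_of_stein {β : ℝ} (hβ : 1 ≤ β) (hp : 0 ≤ p)
    (hpβ : p ≤ algebraMap ℝ 𝒜 β) (hx : star x * p * x + 1 ≤ p) {z : ℂ} (hz : z ∈ spectrum ℂ x) :
    ‖z‖ ^ 2 ≤ 1 - β⁻¹ :=
  norm_sq_le_of_mem_spectrum_of_star_mul_mul_le_smul (sub_nonneg.2 (inv_le_one_of_one_le₀ hβ))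
    (isStrictlyPositive_one.of_le (one_le_of_stein hp hx))
    (star_mul_mul_le_smul_of_stein (zero_lt_one.trans_le hβ) hpβ hx) hz

theorem norm_le_of_stein_of_resolvent (hp : 0 ≤ p) (hx : star x * p * x + 1 ≤ p) {z : ℂ}
    (hz : ‖z‖ = 1) {r : 𝒜} (hr : (algebraMap ℂ 𝒜 z - x) * r = 1) : ‖r‖ ≤ 2 * ‖p‖ := by
  have hxr : x * r = z • r - 1 := by
    rw [← hr, sub_mul, Algebra.algebraMap_eq_smul_one, smul_mul_assoc, one_mul, sub_sub_cancel]
  have hzz : conj z * z = 1 := by simpa [hz] using Complex.conj_mul' z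
  have hconj : star r * (star x * p * x + 1) * r =
      star r * p * r - (conj z • (star r * p) + z • (p * r)) + p + star r * r := by
    have : star r * (star x * p * x + 1) * r = star (x * r) * p * (x * r) + star r * r := by
      rw [star_mul]
      noncomm_ring
    rw [this, hxr, star_sub, star_smul, star_one]
    simp only [sub_mul, mul_sub, smul_mul_assoc, mul_smul_comm, one_mul, mul_one, smul_smul,
      smul_sub]
    rw [show star z = conj z from rfl, mul_comm z, hzz]
    simp only [one_smul]
    abel
  have hle : star r * r ≤ conj z • (star r * p) + z • (p * r) := by
    have h := hconj ▸ star_left_conjugate_le_conjugate hx r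
    rw [← sub_nonneg] at h ⊢
    refine (add_nonneg h hp).trans_eq ?_
    abel
  have hsq : ‖r‖ * ‖r‖ ≤ 2 * ‖p‖ * ‖r‖ := by
    calc ‖r‖ * ‖r‖ = ‖star r * r‖ := CStarRing.norm_star_mul_self.symm
      _ ≤ ‖conj z • (star r * p) + z • (p * r)‖ :=
        CStarAlgebra.norm_le_norm_of_nonneg_of_le (star_mul_self_nonneg r) hle
      _ ≤ ‖star r * p‖ + ‖p * r‖ := by
        refine (norm_add_le _ _).trans_eq ?_
        rw [norm_smul, norm_smul, RCLike.norm_conj, hz, one_mul, one_mul]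
      _ ≤ ‖star r‖ * ‖p‖ + ‖p‖ * ‖r‖ := add_le_add (norm_mul_le _ _) (norm_mul_le _ _)
      _ = 2 * ‖p‖ * ‖r‖ := by rw [norm_star]; ring
  rcases (norm_nonneg r).eq_or_lt with h0 | h0
  · rw [← h0]; positivity
  · exact le_of_mul_le_mul_right hsq h0
end Stein

section Margins

open scoped MatrixOrder ComplexOrder

variable {n : ℕ} {X P : Matrix (Fin n) (Fin n) ℝ} {β : ℝ}

theorem toComplex_eq_mapMatrix (X : Matrix (Fin n) (Fin n) ℝ) :
    toComplex X = Complex.ofRealHom.mapMatrix X := rfl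

theorem star_toComplex (X : Matrix (Fin n) (Fin n) ℝ) : star (toComplex X) = toComplex Xᵀ := by
  ext i j
  simp [toComplex, Matrix.star_apply]

theorem toComplex_nonneg (hX : 0 ≤ X) : 0 ≤ toComplex X := by
  obtain ⟨S, rfl⟩ := CStarAlgebra.nonneg_iff_eq_star_mul_self.1 hX
  have hfactor : toComplex (star S * S) = star (toComplex S) * toComplex S := by
    rw [star_toComplex]
    exact map_mul Complex.ofRealHom.mapMatrix (star S) S
  exact hfactor ▸ star_mul_self_nonneg _

theorem toComplex_mono :
    Monotone (toComplex : Matrix (Fin n) (Fin n) ℝ → Matrix (Fin n) (Fin n) ℂ) := fun X Y hXY => by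
  have hsub := toComplex_nonneg (sub_nonneg.2 hXY)
  rwa [toComplex_eq_mapMatrix, map_sub, sub_nonneg] at hsub

theorem toComplex_algebraMap (t : ℝ) :
    toComplex (algebraMap ℝ (Matrix (Fin n) (Fin n) ℝ) t) = algebraMap ℝ _ t := by
  ext i j
  simp only [toComplex, Matrix.map_apply, Matrix.algebraMap_matrix_apply]
  split_ifs <;> rfl

theorem toComplex_stein_le (hX : Xᵀ * P * X + 1 ≤ P) :
    star (toComplex X) * toComplex P * toComplex X + 1 ≤ toComplex P := by
  have hmono := toComplex_mono hX
  rw [star_toComplex]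
  simpa only [toComplex_eq_mapMatrix, map_add, map_mul, map_one] using hmono

theorem norm_sq_le_of_mem_spectrum_toComplex (hβ : 1 ≤ β) (hP : 0 ≤ P)
    (hPβ : P ≤ algebraMap ℝ _ β) (hX : Xᵀ * P * X + 1 ≤ P) {z : ℂ}
    (hz : z ∈ spectrum ℂ (toComplex X)) : ‖z‖ ^ 2 ≤ 1 - β⁻¹ :=
  norm_sq_le_of_mem_spectrum_of_stein hβ (toComplex_nonneg hP)
    (toComplex_algebraMap (n := n) β ▸ toComplex_mono hPβ) (toComplex_stein_le hX) hz

theorem specRadius_le_of_stein (hβ : 1 ≤ β) (hP : 0 ≤ P) (hPβ : P ≤ algebraMap ℝ _ β)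
    (hX : Xᵀ * P * X + 1 ≤ P) : specRadius X ≤ 1 - (2 * β)⁻¹ := by
  have hβ_inv : β⁻¹ ≤ 1 := inv_le_one_of_one_le₀ hβ
  have hhalf : (2 * β)⁻¹ = β⁻¹ / 2 := by rw [mul_inv, div_eq_inv_mul]
  refine ENNReal.toReal_le_of_le_ofReal (by linarith) (iSup₂_le fun z hz => ?_)
  rw [← enorm_eq_nnnorm, ← ofReal_norm]
  refine ENNReal.ofReal_le_ofReal (le_of_sq_le_sq ?_ (by linarith))
  calc ‖z‖ ^ 2 ≤ 1 - β⁻¹ := norm_sq_le_of_mem_spectrum_toComplex hβ hP hPβ hX hz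
    _ ≤ (1 - (2 * β)⁻¹) ^ 2 := by rw [hhalf]; linarith [sq_nonneg (β⁻¹ / 2)]

theorem inv_one_sub_specRadius_le_of_stein (hβ : 1 ≤ β) (hP : 0 ≤ P) (hPβ : P ≤ algebraMap ℝ _ β)
    (hX : Xᵀ * P * X + 1 ≤ P) : specRadius X < 1 ∧ (1 - specRadius X)⁻¹ ≤ 2 * β := by
  have hle := specRadius_le_of_stein hβ hP hPβ hX
  have hpos : 0 < (2 * β)⁻¹ := by positivity
  exact ⟨by linarith, inv_le_of_inv_le₀ (by positivity) (by linarith)⟩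

theorem hInfNorm_le_of_stein (hβ : 1 ≤ β) (hP : 0 ≤ P) (hPβ : P ≤ algebraMap ℝ _ β)
    (hX : Xᵀ * P * X + 1 ≤ P) : hInfNorm X ≤ ENNReal.ofReal (2 * β) := by
  refine iSup_le fun ⟨z, hz⟩ => ENNReal.ofReal_le_ofReal ?_
  have hz_resolvent : IsUnit (z • (1 : Matrix (Fin n) (Fin n) ℂ) - toComplex X) := by
    rw [← Algebra.algebraMap_eq_smul_one, ← spectrum.notMem_iff]
    intro hmem
    have hsq := norm_sq_le_of_mem_spectrum_toComplex hβ hP hPβ hX hmem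
    have hβ_inv : 0 < β⁻¹ := by positivity
    rw [hz] at hsq
    linarith
  have hinv := Matrix.mul_nonsing_inv _ ((Matrix.isUnit_iff_isUnit_det _).1 hz_resolvent)
  rw [← Algebra.algebraMap_eq_smul_one] at hinv ⊢
  have hr := norm_le_of_stein_of_resolvent (toComplex_nonneg hP) (toComplex_stein_le hX) hz hinv
  refine hr.trans ?_
  gcongr
  rw [CStarAlgebra.norm_le_iff_le_algebraMap _ (by positivity) (toComplex_nonneg hP)]
  exact toComplex_algebraMap (n := n) β ▸ toComplex_mono hPβ

end Margins

section RobustlyCoupled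

open scoped MatrixOrder

variable {n p : ℕ} {A : Matrix (Fin n) (Fin n) ℝ} {B : Matrix (Fin n) (Fin p) ℝ}
  {P : Matrix (Fin n) (Fin n) ℝ} {M μ : ℝ}

theorem RobustlyCoupled.one_le_div (hr : RobustlyCoupled μ A B) (hB : ‖B‖ ≤ M) : 1 ≤ M / μ := by
  obtain ⟨hμ, U, hU, hσ, -⟩ := hr
  exact (_root_.one_le_div hμ).2 (hU.le_of_le_singularValue_inputBlock hB hσ)

theorem RobustlyCoupled.exists_inputResponse_eq (hr : RobustlyCoupled μ A B)
    (hctrb : Controllable A B) (hM : 1 ≤ M) (hA : ‖A‖ ≤ M) (hB : ‖B‖ ≤ M)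
    (w : EuclideanSpace ℝ (Fin n)) :
    ∃ u : Fin (ctrbIndex A B) → EuclideanSpace ℝ (Fin p),
      inputResponse A.toEuclideanLin B.toEuclideanLin u = w ∧
        ∑ j, ‖u j‖ ≤ (3 * (M / μ)) ^ ctrbIndex A B * ‖w‖ := by
  obtain ⟨hμ, U, hU, hσB, hσA⟩ := hr
  refine LQR.exists_inputResponse_eq (S := stairSpace A B U) hM hμ
    (hU.le_of_le_singularValue_inputBlock hB hσB) (norm_toEuclideanLin_apply_le hA)
    (fun w hw => hU.exists_input_eq_of_mem_stairSpace hμ hσB hw)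
    (fun i hi hik w hw => hU.exists_predecessor_of_mem_stairSpace hμ (hσA i hi hik) hw)
    hctrb.ctrbIndex_mem.1 w ?_
  rw [hctrb.stairSpace_ctrbIndex]
  trivial

theorem RobustlyCoupled.le_mul_norm_sq (hr : RobustlyCoupled μ A B) (hctrb : Controllable A B)
    (hM : 1 ≤ M) (hA : ‖A‖ ≤ M) (hB : ‖B‖ ≤ M) {V : EuclideanSpace ℝ (Fin n) → ℝ} (hV₀ : V 0 ≤ 0)
    (hV : ∀ x u, V x ≤ ‖x‖ ^ 2 + ‖u‖ ^ 2 + V (A.toEuclideanLin x + B.toEuclideanLin u))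
    (x : EuclideanSpace ℝ (Fin n)) :
    V x ≤ ctrbIndex A B * (M ^ ctrbIndex A B) ^ 2 * (1 + (3 * (M / μ) * M) ^ ctrbIndex A B) ^ 2 *
      ‖x‖ ^ 2 := by
  have hratio : 0 ≤ M / μ := zero_le_one.trans (hr.one_le_div hB)
  have hγ : 0 ≤ 3 * (M / μ) := by positivity
  have hA_apply := norm_toEuclideanLin_apply_le hA
  have hB_apply := norm_toEuclideanLin_apply_le hB
  exact le_mul_norm_sq_of_exists_inputResponse_eq (R := ℝ) hM hA_apply hB_apply hV₀ hV hγ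
    (hr.exists_inputResponse_eq hctrb hM hA hB) x

theorem dotProduct_self_eq_norm_sq {ι : Type*} [Fintype ι] (x : EuclideanSpace ℝ ι) :
    x.ofLp ⬝ᵥ x.ofLp = ‖x‖ ^ 2 := by
  rw [← real_inner_self_eq_norm_sq, EuclideanSpace.inner_eq_star_dotProduct, star_trivial]

theorem RobustlyCoupled.riccati_le (hr : RobustlyCoupled μ A B) (hctrb : Controllable A B)
    (hM : 1 ≤ M) (hA : ‖A‖ ≤ M) (hB : ‖B‖ ≤ M) (hP : IsRiccatiSolution A B 1 1 P)
    (hP₀ : P.PosSemidef) :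
    P ≤ algebraMap ℝ _ (ctrbIndex A B * (M ^ ctrbIndex A B) ^ 2 *
      (1 + (3 * (M / μ) * M) ^ ctrbIndex A B) ^ 2) := by
  have hstage (x : EuclideanSpace ℝ (Fin n)) (u : EuclideanSpace ℝ (Fin p)) :
      x.ofLp ⬝ᵥ P *ᵥ x.ofLp ≤ ‖x‖ ^ 2 + ‖u‖ ^ 2 +
        (A *ᵥ x.ofLp + B *ᵥ u.ofLp) ⬝ᵥ P *ᵥ (A *ᵥ x.ofLp + B *ᵥ u.ofLp) := by
    simpa [dotProduct_self_eq_norm_sq] using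
      hP.dotProduct_mulVec_le hP₀ Matrix.PosDef.one x.ofLp u.ofLp
  rw [Matrix.le_iff]
  refine Matrix.PosSemidef.of_dotProduct_mulVec_nonneg
    ((IsSelfAdjoint.algebraMap _ (IsSelfAdjoint.all _)).sub hP₀.isHermitian) fun x => ?_
  have hVx := hr.le_mul_norm_sq hctrb hM hA hB (V := fun x => x.ofLp ⬝ᵥ P *ᵥ x.ofLp) (by simp)
    hstage (WithLp.toLp 2 x)
  rw [← dotProduct_self_eq_norm_sq] at hVx
  simpa [Matrix.sub_mulVec, Algebra.algebraMap_eq_smul_one, Matrix.smul_mulVec] using hVx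

/-- Twice the bound on the Riccati solution, with `(3 (M / μ) M) ^ κ` replaced by a power of the
product of the first two variables, `q ^ κ` and `M ^ κ`; the third variable is `κ`. -/
noncomputable def marginPolynomial (m : ℕ) : MvPolynomial (Fin 3) ℝ :=
  MvPolynomial.C 2 * (MvPolynomial.X 2 * MvPolynomial.X 1 ^ 2 *
    (1 + (MvPolynomial.X 0 * MvPolynomial.X 1) ^ (m + 1)) ^ 2)

theorem eval_marginPolynomial (m : ℕ) (s t k : ℝ) :
    MvPolynomial.eval ![s, t, k] (marginPolynomial m) =
      2 * (k * t ^ 2 * (1 + (s * t) ^ (m + 1)) ^ 2) := by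
  simp [marginPolynomial]

theorem three_mul_pow_le {c q a : ℝ} {m : ℕ} (hc : 0 ≤ c) (hcm : 3 ≤ c ^ m) (ha : 0 ≤ a)
    (haq : a ≤ q) (hM : 0 ≤ M) (hcq : c ≤ M * q) (k : ℕ) :
    (3 * a * M) ^ k ≤ (q ^ k * M ^ k) ^ (m + 1) := by
  have hq : 0 ≤ q := ha.trans haq
  have h3 : 3 ≤ (M * q) ^ m := hcm.trans (by gcongr)
  calc (3 * a * M) ^ k ≤ ((M * q) ^ m * q * M) ^ k := by gcongr
    _ = (q ^ k * M ^ k) ^ (m + 1) := by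
      rw [← mul_pow, ← pow_mul, mul_comm k, pow_mul]
      ring

theorem RobustlyCoupled.margins (hr : RobustlyCoupled μ A B) (hctrb : Controllable A B)
    (hM : 1 ≤ M) (hA : ‖A‖ ≤ M) (hB : ‖B‖ ≤ M) (hP : IsRiccatiSolution A B 1 1 P)
    (hP₀ : P.PosSemidef) {c q : ℝ} {m : ℕ} (hc : 0 ≤ c) (hcm : 3 ≤ c ^ m) (hq : M / μ ≤ q)
    (hcq : c ≤ M * q) :
    specRadius (A + B * lqrGain A B 1 P) < 1 ∧
      (1 - specRadius (A + B * lqrGain A B 1 P))⁻¹ ≤ MvPolynomial.eval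
        ![q ^ ctrbIndex A B, M ^ ctrbIndex A B, (ctrbIndex A B : ℝ)] (marginPolynomial m) ∧
      hInfNorm (A + B * lqrGain A B 1 P) ≤ ENNReal.ofReal (MvPolynomial.eval
        ![q ^ ctrbIndex A B, M ^ ctrbIndex A B, (ctrbIndex A B : ℝ)] (marginPolynomial m)) := by
  rw [eval_marginPolynomial]
  set k := ctrbIndex A B
  set β : ℝ := k * (M ^ k) ^ 2 * (1 + (q ^ k * M ^ k) ^ (m + 1)) ^ 2
  have hratio : 0 ≤ M / μ := zero_le_one.trans (hr.one_le_div hB)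
  have hpow := three_mul_pow_le hc hcm hratio hq (zero_le_one.trans hM) hcq k
  have hβ : 1 ≤ β := by
    have hk : (1 : ℝ) ≤ k := by exact_mod_cast hctrb.ctrbIndex_mem.1
    have hsteer : 0 ≤ (3 * (M / μ) * M) ^ k := by positivity
    exact one_le_mul_of_one_le_of_one_le
      (one_le_mul_of_one_le_of_one_le hk (one_le_pow₀ (one_le_pow₀ hM)))
      (one_le_pow₀ (le_add_of_nonneg_right (hsteer.trans hpow)))
  have hPβ : P ≤ algebraMap ℝ _ β :=
    (hr.riccati_le hctrb hM hA hB hP hP₀).trans (algebraMap_mono _ (by unfold β; gcongr))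
  have hstein := hP.stein_le hP₀ Matrix.PosDef.one
  obtain ⟨hlt, hinv⟩ := inv_one_sub_specRadius_le_of_stein hβ hP₀.nonneg hPβ hstein
  exact ⟨hlt, hinv, hInfNorm_le_of_stein hβ hP₀.nonneg hPβ hstein⟩

end RobustlyCoupled

end LQR

theorem mainTheorem9 (c : ℝ) (hc : 1 < c) :
    ∃ F : MvPolynomial (Fin 3) ℝ,
      ∀ (n p : ℕ) (A : Matrix (Fin n) (Fin n) ℝ) (B : Matrix (Fin n) (Fin p) ℝ) (M μ : ℝ)
        (P : Matrix (Fin n) (Fin n) ℝ) (K : Matrix (Fin p) (Fin n) ℝ) (κ : ℕ),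
        1 ≤ M → ‖A‖ ≤ M → ‖B‖ ≤ M →
        LQR.Controllable A B → LQR.RobustlyCoupled μ A B → κ = LQR.ctrbIndex A B →
        P.PosDef → LQR.IsRiccatiSolution A B 1 1 P → K = LQR.lqrGain A B 1 P →
        LQR.specRadius (A + B * K) < 1 ∧
        ((1 - LQR.specRadius (A + B * K))⁻¹
            ≤ MvPolynomial.eval ![(c * M / μ) ^ κ, M ^ κ, (κ : ℝ)] F ∧
          LQR.hInfNorm (A + B * K)
            ≤ ENNReal.ofReal (MvPolynomial.eval ![(c * M / μ) ^ κ, M ^ κ, (κ : ℝ)] F)) ∧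
        (c ≤ M ∨ c ≤ M / μ →
          (1 - LQR.specRadius (A + B * K))⁻¹
              ≤ MvPolynomial.eval ![(M / μ) ^ κ, M ^ κ, (κ : ℝ)] F ∧
          LQR.hInfNorm (A + B * K)
              ≤ ENNReal.ofReal (MvPolynomial.eval ![(M / μ) ^ κ, M ^ κ, (κ : ℝ)] F)) := by
  obtain ⟨m, hm⟩ := pow_unbounded_of_one_lt (3 : ℝ) hc
  refine ⟨LQR.marginPolynomial m, ?_⟩
  rintro n p A B M μ P _ _ hM hA hB hctrb hr rfl hP₀ hP rfl
  have hc₀ : 0 ≤ c := zero_le_one.trans hc.le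
  have hratio : 1 ≤ M / μ := hr.one_le_div hB
  have margins {q : ℝ} (hq : M / μ ≤ q) (hcq : c ≤ M * q) :=
    hr.margins hctrb hM hA hB hP hP₀.posSemidef hc₀ hm.le hq hcq
  have hscaled : M / μ ≤ c * M / μ := by
    rw [mul_div_assoc]
    exact le_mul_of_one_le_left (zero_le_one.trans hratio) hc.le
  have hc_scaled : c ≤ c * M / μ := by
    rw [mul_div_assoc]
    exact le_mul_of_one_le_right hc₀ hratio
  obtain ⟨hstable, hbounds⟩ :=
    margins hscaled (hc_scaled.trans (le_mul_of_one_le_left (hc₀.trans hc_scaled) hM))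
  refine ⟨hstable, hbounds, fun hlarge => (margins le_rfl ?_).2⟩
  rcases hlarge with hcM | hcμ
  · exact hcM.trans (le_mul_of_one_le_right (zero_le_one.trans hM) hratio)
  · exact hcμ.trans (le_mul_of_one_le_left (zero_le_one.trans hratio) hM)
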